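/- Let $d\ge 1$, $1\le m\le N$ be integers, $\theta>0$, $\alpha^1,\dots,\alpha^N\ge 0$ and $\delta_1,\dots,\delta_N>0$ real numbers, $\mathcal A=\{\alpha^1,\dots,\alpha^N\}\subset\mathbb R$. Let $F$ be the Fourier transform on the complex space $L_2(\mathbb R^d)$ (with kernel $e^{-i\langle t,\xi\rangle}$), $\psi_\theta(\xi)=(|\xi_1|^\theta+\dots+|\xi_d|^\theta)^{2/\theta}$, and $\Lambda_\theta^{\alpha}x=F^{-1}(\psi_\theta^{\alpha}Fx)$. Put $$\mathcal W=\mathcal W_\theta=\{x\in L_2(\mathbb R^d):\ \psi_\theta^{\alpha^j}Fx\in L_2(\mathbb R^d),\ j=1,\dots,N\},\qquad W=\{x\in\mathcal W:\ \|\Lambda_\theta^{\alpha^j}x\|_{L_2}\le\delta_j,\ j=m+1,\dots,N\}.$$ For $\alpha^0\in\operatorname{co}\mathcal A$ and a map (method) $\Phi:(L_2(\mathbb R^d))^m\to L_2(\mathbb R^d)$ let $$e(\Phi)=\sup\{\|\Lambda_\theta^{\alpha^0}x-\Phi(y)\|_{L_2}:\ x\in W,\ y=(y_1,\dots,y_m)\in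 (L_2(\mathbb R^d))^m,\ \|\Lambda_\theta^{\alpha^j}x-y_j\|_{L_2}\le\delta_j,\ j=1,\dots,m\},$$ and $E=\inf_\Phi e(\Phi)$, the infimum over all maps $\Phi$. A method $\Phi$ is optimal if $e(\Phi)=E$. Let $Q=\operatorname{co}\{(\alpha^j,\ln 1/\delta_j): j=1,\dots,N\}\subset\mathbb R^2$ and $S(\alpha)=\max\{z:(\alpha,z)\in Q\}$ for $\alpha\in\operatorname{co}\mathcal A$. An inequality $\|\Lambda_0x\|\le\kappa(\|\Lambda_1x\|,\dots,\|\Lambda_nx\|)$ on a space $X$ is called exact if it holds for all $x\in X$ and there is no $x_0\in X$ with $\sup\{\|\Lambda_0x\|: x\in X,\ \|\Lambda_ix\|\le\|\Lambda_ix_0\|,\ i=1,\dots,n\}<\kappa(\|\Lambda_1x_0\|,\dots,\|\Lambda_nx_0\|)$. **Corollary 2.** Let $\alpha^0\in\operatorname{co}\mathcal A$, $\alpha^0\notin\mathcal A$. Then $\psi_\theta^{\alpha^0}Fx\in L_2(\mathbb R^d)$ for all $x\in\mathcal W$, and $$E=e^{-S(\alpha^0)}.$$ There exist a support line $z=\eta\alpha+c$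 to the graph of $S$ at $\alpha^0$ (that is, $S(\alpha)\le\eta\alpha+c$ on $\operatorname{co}\mathcal A$, with equality at $\alpha^0$), indices $j_1,j_2$ such that the points $(\alpha^{j_s},\ln1/\delta_{j_s})$, $s=1,2$, lie on this line, and $\theta_{j_1}\in(0,1)$ with $\alpha^0=\theta_{j_1}\alpha^{j_1}+(1-\theta_{j_1})\alpha^{j_2}$. For every such choice, with $M=\{j_1,j_2\}\cap\{1,\dots,m\}$, the following holds. 1. There are measurable functions $a_{j_1},a_{j_2}:\mathbb R^d\to\mathbb C$ satisfying $$\psi_\theta^{\alpha^{j_1}}(\xi)a_{j_1}(\xi)+\psi_\theta^{\alpha^{j_2}}(\xi)a_{j_2}(\xi)=\psi_\theta^{\alpha^0}(\xi),\qquad \frac{\delta_{j_1}^2|a_{j_1}(\xi)|^2}{\theta_{j_1}}+\frac{\delta_{j_2}^2|a_{j_2}(\xi)|^2}{1-\theta_{j_1}}\le e^{-2S(\alpha^0)}$$ for almost all $\xi\in\mathbb R^d$. If $M\ne\emptyset$, then for all such functions $\sum_{j\in M}a_jFy_j\in L_2(\mathbb R^d)$ for every $y\in (L_2(\mathbb R^d))^m$,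 and the method $\Phi(y)=F^{-1}\big(\sum_{j\in M}a_jFy_j\big)$ is optimal. 2. If $M=\emptyset$, then the method $\Phi(y)=0$ is optimal. 3. The inequality $$\|\Lambda_\theta^{\alpha^0}x\|_{L_2(\mathbb R^d)}\le\|\Lambda_\theta^{\alpha^{j_1}}x\|_{L_2(\mathbb R^d)}^{\theta_{j_1}}\,\|\Lambda_\theta^{\alpha^{j_2}}x\|_{L_2(\mathbb R^d)}^{1-\theta_{j_1}}$$ on $\mathcal W_\theta$, between $\Lambda_\theta^{\alpha^0}$ and the two operators $\Lambda_\theta^{\alpha^{j_1}},\Lambda_\theta^{\alpha^{j_2}}$, is exact. 4. In particular (case $\theta=2$), with $(-\Delta)^{\alpha}x=F^{-1}(|\xi|^{2\alpha}Fx)$, the inequality $$\|(-\Delta)^{\alpha^0}x\|_{L_2(\mathbb R^d)}\le\|(-\Delta)^{\alpha^{j_1}}x\|_{L_2(\mathbb R^d)}^{\theta_{j_1}}\,\|(-\Delta)^{\alpha^{j_2}}x\|_{L_2(\mathbb R^d)}^{1-\theta_{j_1}}$$ on $\mathcal W_2$ is exact. -/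

import Mathlib

open MeasureTheory FourierTransform
open scoped ENNReal

noncomputable section

namespace OptRec

/-! ### Optimal recovery from inaccurate information -/

section General

variable {X Y Y₀ : Type*} [NormedAddCommGroup Y] [NormedAddCommGroup Y₀] {m : ℕ}

/-- The error of the method `Φ`: the supremum of `‖Λ₀ x - Φ y‖` over all `x ∈ W` and all
`y = (y₁, …, y_m)` with `‖Λ_j x - y_j‖ ≤ δ_j`, with values in `[0, ∞]`. -/
def methodError (Λ₀ : X → Y₀) (Λ : Fin m → X → Y) (W : Set X) (δ : Fin m → ℝ)
    (Φ : (Fin m → Y) → Y₀) : ℝ≥0∞ :=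
  ⨆ (x : X) (_ : x ∈ W) (y : Fin m → Y) (_ : ∀ j, ‖Λ j x - y j‖ ≤ δ j), ‖Λ₀ x - Φ y‖ₑ

/-- The error of optimal recovery: the infimum of the errors over all maps `Φ : Y^m → Y₀`. -/
def optimalError (Λ₀ : X → Y₀) (Λ : Fin m → X → Y) (W : Set X) (δ : Fin m → ℝ) : ℝ≥0∞ :=
  ⨅ Φ : (Fin m → Y) → Y₀, methodError Λ₀ Λ W δ Φ

/-- A method is optimal if its error is the error of optimal recovery. -/
def IsOptimalMethod (Λ₀ : X → Y₀) (Λ : Fin m → X → Y) (W : Set X) (δ : Fin m → ℝ)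
    (Φ : (Fin m → Y) → Y₀) : Prop :=
  methodError Λ₀ Λ W δ Φ = optimalError Λ₀ Λ W δ

/-- The inequality `‖Λ₀ x‖ ≤ κ (‖Λ₁ x‖, …, ‖Λ_n x‖)` on `D` is exact: it holds for all `x ∈ D`, and
there is no `x₀ ∈ D` for which the supremum of `‖Λ₀ x‖` over the `x ∈ D` with
`‖Λ_i x‖ ≤ ‖Λ_i x₀‖` for all `i` is smaller than `κ (‖Λ₁ x₀‖, …, ‖Λ_n x₀‖)`. -/
def IsExactInequality {n : ℕ} (D : Set X) (Λ₀ : X → Y₀) (Λ : Fin n → X → Y)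
    (κ : (Fin n → ℝ) → ℝ) : Prop :=
  (∀ x ∈ D, ‖Λ₀ x‖ ≤ κ fun i => ‖Λ i x‖) ∧
  ¬ ∃ x₀ ∈ D,
      (⨆ (x : X) (_ : x ∈ D) (_ : ∀ i, ‖Λ i x‖ ≤ ‖Λ i x₀‖), ‖Λ₀ x‖ₑ)
        < ENNReal.ofReal (κ fun i => ‖Λ i x₀‖)

end General

/-! ### The Fourier transform on `L₂(ℝ^d)` -/

/-- `ℝ^d` with the Euclidean norm. -/
abbrev RSpace (d : ℕ) : Type := EuclideanSpace ℝ (Fin d)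

/-- The complex space `L₂(ℝ^d)`. -/
abbrev L2 (d : ℕ) : Type := Lp ℂ 2 (volume : Measure (RSpace d))

/-- The Fourier transform on `L₂(ℝ^d)` with kernel `e^{-i⟨t, ξ⟩}`, as a function defined almost
everywhere. Mathlib's transform has the kernel `e^{-2πi⟨t, ξ⟩}`, whence the dilation. -/
def fourierF {d : ℕ} (x : L2 d) : RSpace d → ℂ :=
  fun ξ => (𝓕 x : L2 d) ((2 * Real.pi)⁻¹ • ξ)

theorem memLp_dilate {d : ℕ} {g : RSpace d → ℂ} (hg : MemLp g 2 volume) :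
    MemLp (fun η : RSpace d => g ((2 * Real.pi) • η)) 2 volume := by
  have h2 : (2 * Real.pi : ℝ) ≠ 0 := by positivity
  have hmap := Measure.map_addHaar_smul (volume : Measure (RSpace d)) h2
  have hg' : MemLp g 2 (Measure.map (fun η : RSpace d => (2 * Real.pi) • η) volume) := by
    have := hg.smul_measure (c := ENNReal.ofReal
      |((2 * Real.pi) ^ Module.finrank ℝ (RSpace d))⁻¹|) ENNReal.ofReal_ne_top
    rw [← hmap] at this
    exact this
  exact hg'.comp_of_map (measurable_const_smul _).aemeasurable

open Classical in
/-- The inverse of `fourierF`, applied to a function `g ∈ L₂(ℝ^d)`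
(and the value `0` if `g` is not square integrable). -/
def fourierFInv {d : ℕ} (g : RSpace d → ℂ) : L2 d :=
  if hg : MemLp g 2 volume then 𝓕⁻ ((memLp_dilate hg).toLp _ : L2 d) else 0

/-- The operator `x ↦ F⁻¹(w F x)` with symbol `w`; used for those `x` with `w F x ∈ L₂(ℝ^d)`. -/
def fourierMultiplier {d : ℕ} (w : RSpace d → ℝ) (x : L2 d) : L2 d :=
  fourierFInv fun ξ => (w ξ : ℂ) * fourierF x ξ

/-- `ψ_θ(ξ) = (|ξ₁|^θ + … + |ξ_d|^θ)^{2/θ}`. -/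
def psi {d : ℕ} (θ : ℝ) (ξ : RSpace d) : ℝ :=
  (∑ i, |ξ i| ^ θ) ^ (2 / θ)

/-- The operator `Λ_θ^a x = F⁻¹(ψ_θ^a F x)`. -/
def Lam {d : ℕ} (θ a : ℝ) : L2 d → L2 d :=
  fourierMultiplier fun ξ => psi θ ξ ^ a

/-- The fractional power `(-Δ)^a` of minus the Laplace operator: the operator with
symbol `|ξ|^{2a}`. -/
def fracLaplacian {d : ℕ} (a : ℝ) : L2 d → L2 d :=
  fourierMultiplier fun ξ => ‖ξ‖ ^ (2 * a)

/-- `x ∈ L₂(ℝ^d)` with `ψ_θ^a F x ∈ L₂(ℝ^d)`. -/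
def InDomain {d : ℕ} (θ a : ℝ) (x : L2 d) : Prop :=
  MemLp (fun ξ : RSpace d => ((psi θ ξ ^ a : ℝ) : ℂ) * fourierF x ξ) 2 volume

/-- The space of all `x ∈ L₂(ℝ^d)` with `ψ_θ^{α_j} F x ∈ L₂(ℝ^d)` for all `j`. -/
def functionSpace {d N : ℕ} (θ : ℝ) (α : Fin N → ℝ) : Set (L2 d) :=
  {x | ∀ j, InDomain θ (α j) x}

/-- The class of all `x` in `functionSpace θ α` with `‖Λ_θ^{α_j} x‖ ≤ δ_j` for the indices `j`
beyond the first `m` ones. -/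
def functionClass {d N : ℕ} (m : ℕ) (θ : ℝ) (α δ : Fin N → ℝ) : Set (L2 d) :=
  {x | x ∈ functionSpace θ α ∧ ∀ j : Fin N, m ≤ (j : ℕ) → ‖Lam θ (α j) x‖ ≤ δ j}

/-! ### The concave broken line `S` -/

/-- The convex hull of the points `(α_j, ln (1/δ_j))`. -/
def hullQ {N : ℕ} (α δ : Fin N → ℝ) : Set (ℝ × ℝ) :=
  convexHull ℝ (Set.range fun j => (α j, Real.log (1 / δ j)))

/-- `S(a) = max {z : (a, z) ∈ Q}`, for `a` in the convex hull of the `α_j`. -/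
def broken {N : ℕ} (α δ : Fin N → ℝ) (a : ℝ) : ℝ :=
  sSup {z : ℝ | (a, z) ∈ hullQ α δ}

/-- On the convex hull of the `α_j` the maximum in the definition of `S` is attained. -/
theorem broken_isGreatest {N : ℕ} (α δ : Fin N → ℝ) {a : ℝ}
    (ha : a ∈ convexHull ℝ (Set.range α)) :
    IsGreatest {z : ℝ | (a, z) ∈ hullQ α δ} (broken α δ a) := by
  have hQ : IsCompact (hullQ α δ) := (Set.finite_range _).isCompact_convexHull ℝ
  have himg : {z : ℝ | (a, z) ∈ hullQ α δ} = Prod.snd '' (hullQ α δ ∩ Prod.fst ⁻¹' {a}) := by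
    ext z
    constructor
    · intro hz
      exact ⟨(a, z), ⟨hz, rfl⟩, rfl⟩
    · rintro ⟨⟨b, w⟩, ⟨h1, h2⟩, rfl⟩
      simp only [Set.mem_preimage, Set.mem_singleton_iff] at h2
      subst h2
      exact h1
  have hc : IsCompact {z : ℝ | (a, z) ∈ hullQ α δ} := by
    rw [himg]
    exact (hQ.inter_right (isClosed_singleton.preimage continuous_fst)).image continuous_snd
  have hproj : Prod.fst '' hullQ α δ = convexHull ℝ (Set.range α) := by
    have := (LinearMap.fst ℝ ℝ ℝ).image_convexHull
      (Set.range fun j => (α j, Real.log (1 / δ j)))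
    rw [← Set.range_comp] at this
    exact this
  rw [← hproj] at ha
  obtain ⟨⟨b, z⟩, h1, rfl⟩ := ha
  exact hc.isGreatest_sSup ⟨z, h1⟩

/-- The line `z = η a + c` is a support line of the graph of `S` at `a₀`, the points
`(α_j, ln (1/δ_j))`, `j = j₁, j₂`, lie on it, and `a₀ = t α_{j₁} + (1 - t) α_{j₂}`, `0 < t < 1`. -/
structure IsSupportPair {N : ℕ} (α δ : Fin N → ℝ) (a₀ η c : ℝ) (j₁ j₂ : Fin N) (t : ℝ) :
    Prop where
  support : ∀ a ∈ convexHull ℝ (Set.range α), broken α δ a ≤ η * a + c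
  touch : broken α δ a₀ = η * a₀ + c
  mem₁ : Real.log (1 / δ j₁) = η * α j₁ + c
  mem₂ : Real.log (1 / δ j₂) = η * α j₂ + c
  pos : 0 < t
  lt_one : t < 1
  comb : a₀ = t * α j₁ + (1 - t) * α j₂

/-! ### The recovery methods -/

/-- `M = {j₁, j₂} ∩ {1, …, m}`, as a set of indices among the first `m` ones. -/
def indexM {N m : ℕ} (hm : m ≤ N) (j₁ j₂ : Fin N) : Finset (Fin m) :=
  {j | Fin.castLE hm j = j₁ ∨ Fin.castLE hm j = j₂}

/-- The function `∑_{j ∈ M} a_j F y_j`. -/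
def methodSymbol {d N m : ℕ} (hm : m ≤ N) (j₁ j₂ : Fin N) (a : Fin N → RSpace d → ℂ)
    (y : Fin m → L2 d) : RSpace d → ℂ :=
  fun ξ => ∑ j ∈ indexM hm j₁ j₂, a (Fin.castLE hm j) ξ * fourierF (y j) ξ

/-- The method `Φ(y) = F⁻¹(∑_{j ∈ M} a_j F y_j)`. -/
def method {d N m : ℕ} (hm : m ≤ N) (j₁ j₂ : Fin N) (a : Fin N → RSpace d → ℂ)
    (y : Fin m → L2 d) : L2 d :=
  fourierFInv (methodSymbol hm j₁ j₂ a y)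

/-- The conditions on the functions `a_{j₁}`, `a_{j₂}`: they are measurable, and for almost all `ξ`
`ψ_θ^{α_{j₁}} a_{j₁} + ψ_θ^{α_{j₂}} a_{j₂} = ψ_θ^{a₀}` and
`δ_{j₁}² |a_{j₁}|² / t + δ_{j₂}² |a_{j₂}|² / (1 - t) ≤ e^{-2 S(a₀)}`. -/
structure IsAdmissible {d N : ℕ} (θ : ℝ) (α δ : Fin N → ℝ) (a₀ : ℝ) (j₁ j₂ : Fin N) (t : ℝ)
    (a : Fin N → RSpace d → ℂ) : Prop where
  meas₁ : AEStronglyMeasurable (a j₁) volume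
  meas₂ : AEStronglyMeasurable (a j₂) volume
  eq : ∀ᵐ ξ : RSpace d, ((psi θ ξ ^ α j₁ : ℝ) : ℂ) * a j₁ ξ + ((psi θ ξ ^ α j₂ : ℝ) : ℂ) * a j₂ ξ
    = ((psi θ ξ ^ a₀ : ℝ) : ℂ)
  le : ∀ᵐ ξ : RSpace d, δ j₁ ^ 2 * ‖a j₁ ξ‖ ^ 2 / t + δ j₂ ^ 2 * ‖a j₂ ξ‖ ^ 2 / (1 - t)
    ≤ Real.exp (-2 * broken α δ a₀)

end OptRec

end

namespace OptRec

/-! ### Plancherel's theorem for `fourierF` -/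

section Fourier

variable {d : ℕ}

/-! By Plancherel, each `Lam θ a` acts as multiplication by `ψ_θ^a` on the Fourier side, so every
estimate reduces to a scalar inequality in `ξ` between powers of `p = ψ_θ(ξ)`.

Upper bound: the hard constraints are read as measurements with data `0`. For admissible `a`, the
error of the method has Fourier transform `a_{j₁} F u + a_{j₂} F v`, where `u`, `v` are the
residuals, of norms at most `δ_{j₁}`, `δ_{j₂}`. A weighted Cauchy–Schwarz inequality gives the bound
`e^{-S(a₀)}` (`methodError_method_le`). Admissible functions exist by the weighted inequality of
means for powers of `p` (`rpow_sq_le_weighted`).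

Lower bound: `x` and `-x` are both compatible with zero data, so no method has error below `‖Λ^{a₀}
x‖` for `x` in the class with `‖Λ^{α_k} x‖ ≤ δ_k` for all `k`. Concentrating `F x` near the level
set `ψ_θ = e^{-η}`, with `‖x‖ = e^{-c}`, gives `‖Λ^a x‖` close to `e^{-(ηa + c)}`
(`exists_norm_Lam_le_and_le`). The support line lies above all the points `(α_k, ln 1/δ_k)`, so all
constraints hold, and it meets the graph of `S` at `a₀`, so the bounds agree. The same functions
make the interpolation inequality exact. -/

theorem quasiMeasurePreserving_dilate {r : ℝ} (hr : r ≠ 0) :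
    Measure.QuasiMeasurePreserving (fun ξ : RSpace d => r • ξ) volume volume :=
  Measure.quasiMeasurePreserving_smul volume hr

theorem memLp_fourierF (x : L2 d) : MemLp (fourierF x) 2 volume := by
  have h2 : ((2 * Real.pi)⁻¹ : ℝ) ≠ 0 := by positivity
  have hmap := Measure.map_addHaar_smul (volume : Measure (RSpace d)) h2
  have hg' : MemLp (𝓕 x : L2 d) 2
      (Measure.map (fun η : RSpace d => (2 * Real.pi)⁻¹ • η) volume) := by
    have := (Lp.memLp (𝓕 x : L2 d)).smul_measure (c := ENNReal.ofReal
      |((2 * Real.pi)⁻¹ ^ Module.finrank ℝ (RSpace d))⁻¹|) ENNReal.ofReal_ne_top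
    rw [← hmap] at this
    exact this
  exact hg'.comp_of_map (measurable_const_smul _).aemeasurable

theorem integrable_normSq_fourierF (x : L2 d) :
    Integrable (fun ξ => ‖fourierF x ξ‖ ^ 2) volume :=
  (memLp_fourierF x).integrable_norm_pow (by norm_num)

theorem L2_norm_sq_eq_integral (f : L2 d) : ‖f‖ ^ 2 = ∫ ξ, ‖f ξ‖ ^ 2 := by
  have h := L2.inner_def (𝕜 := ℂ) f f
  rw [inner_self_eq_norm_sq_to_K] at h
  simp only [inner_self_eq_norm_sq_to_K] at h
  have h' : ((‖f‖ ^ 2 : ℝ) : ℂ) = ((∫ ξ, ‖f ξ‖ ^ 2 : ℝ) : ℂ) := by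
    rw [← integral_complex_ofReal]
    simpa using h
  exact_mod_cast h'

/-- The factor `(2π)^{-d}` is the Jacobian of the dilation relating the two normalisations of the
transform. -/
theorem norm_sq_eq_integral_fourierF (x : L2 d) :
    ‖x‖ ^ 2 = ((2 * Real.pi) ^ d)⁻¹ * ∫ ξ, ‖fourierF x ξ‖ ^ 2 := by
  have h := Measure.integral_comp_smul (volume : Measure (RSpace d))
    (fun η => ‖(𝓕 x : L2 d) η‖ ^ 2) (2 * Real.pi)⁻¹
  have hp : (0 : ℝ) < (2 * Real.pi) ^ d := by positivity
  simp only [fourierF]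
  rw [h, finrank_euclideanSpace_fin, inv_pow, inv_inv, abs_of_pos hp, smul_eq_mul,
    inv_mul_cancel_left₀ hp.ne', ← L2_norm_sq_eq_integral, Lp.norm_fourier_eq]

theorem fourierF_congr {x : L2 d} {g : RSpace d → ℂ} (h : (𝓕 x : L2 d) =ᵐ[volume] g) :
    fourierF x =ᵐ[volume] fun ξ => g ((2 * Real.pi)⁻¹ • ξ) :=
  (quasiMeasurePreserving_dilate (by positivity)).ae_eq_comp h

theorem fourierF_sub (x y : L2 d) :
    fourierF (x - y) =ᵐ[volume] fun ξ => fourierF x ξ - fourierF y ξ := by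
  have h : (𝓕 (x - y) : L2 d) = 𝓕 x - 𝓕 y := (Lp.fourierTransformₗᵢ _ _).map_sub x y
  have h' := Lp.coeFn_sub (𝓕 x : L2 d) (𝓕 y)
  rw [← h] at h'
  exact fourierF_congr h'

theorem fourierF_neg (x : L2 d) : fourierF (-x) =ᵐ[volume] fun ξ => -fourierF x ξ := by
  have h' := Lp.coeFn_neg (𝓕 x : L2 d)
  rw [← FourierTransform.fourier_neg] at h'
  exact fourierF_congr h'

theorem fourierF_zero : fourierF (0 : L2 d) =ᵐ[volume] fun _ => 0 := by
  have h' := Lp.coeFn_zero ℂ 2 (volume : Measure (RSpace d))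
  rw [← FourierTransform.fourier_zero (E := L2 d) (F := L2 d)] at h'
  exact fourierF_congr h'

theorem fourierF_fourierFInv {g : RSpace d → ℂ} (hg : MemLp g 2 volume) :
    fourierF (fourierFInv g) =ᵐ[volume] g := by
  have h' := (memLp_dilate hg).coeFn_toLp
  rw [← FourierTransform.fourier_fourierInv_eq (F := L2 d) ((memLp_dilate hg).toLp _ : L2 d)] at h'
  have h := fourierF_congr h'
  have hp : (2 * Real.pi : ℝ) ≠ 0 := by positivity
  simpa only [fourierFInv, dif_pos hg, smul_inv_smul₀ hp] using h

/-- The Fourier transform on `L₂` is injective. -/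
theorem eq_of_fourierF_ae_eq {x y : L2 d} (h : fourierF x =ᵐ[volume] fourierF y) : x = y := by
  have h0 : ‖x - y‖ ^ 2 = 0 := by
    rw [norm_sq_eq_integral_fourierF, integral_eq_zero_of_ae, mul_zero]
    filter_upwards [fourierF_sub x y, h] with ξ h1 h2
    simp [h1, h2]
  exact sub_eq_zero.1 (by simpa using h0)

/-- If `‖F z‖² ≤ b₁ ‖F u‖² + b₂ ‖F v‖²` almost everywhere, the same holds for the norms. -/
theorem norm_sq_le_of_ae_le {z u v : L2 d} {b₁ b₂ : ℝ}
    (h : ∀ᵐ ξ, ‖fourierF z ξ‖ ^ 2 ≤ b₁ * ‖fourierF u ξ‖ ^ 2 + b₂ * ‖fourierF v ξ‖ ^ 2) :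
    ‖z‖ ^ 2 ≤ b₁ * ‖u‖ ^ 2 + b₂ * ‖v‖ ^ 2 := by
  have hu := (integrable_normSq_fourierF u).const_mul b₁
  have hv := (integrable_normSq_fourierF v).const_mul b₂
  have hi := integral_mono_ae (integrable_normSq_fourierF z) (hu.add hv) h
  simp only [Pi.add_apply] at hi
  rw [integral_add hu hv, integral_const_mul, integral_const_mul] at hi
  have hp : (0 : ℝ) ≤ ((2 * Real.pi) ^ d)⁻¹ := by positivity
  rw [norm_sq_eq_integral_fourierF z, norm_sq_eq_integral_fourierF u,
    norm_sq_eq_integral_fourierF v]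
  linarith [mul_le_mul_of_nonneg_left hi hp]

end Fourier

/-! ### The operators `Λ_θ^a` -/

section Lam

variable {d : ℕ} {θ a : ℝ}

theorem psi_nonneg (ξ : RSpace d) : 0 ≤ psi θ ξ :=
  Real.rpow_nonneg (Finset.sum_nonneg fun _ _ => Real.rpow_nonneg (abs_nonneg _) _) _

theorem continuous_psi (hθ : 0 < θ) : Continuous (psi θ : RSpace d → ℝ) := by
  refine Continuous.rpow_const ?_ fun _ => Or.inr (by positivity)
  refine continuous_finsetSum _ fun i _ => ?_
  exact Continuous.rpow_const (by fun_prop) fun _ => Or.inr hθ.le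

theorem continuous_psi_rpow (hθ : 0 < θ) (ha : 0 ≤ a) :
    Continuous fun ξ : RSpace d => psi θ ξ ^ a :=
  (continuous_psi hθ).rpow_const fun _ => Or.inr ha

theorem psi_single (hθ : 0 < θ) (i : Fin d) {r : ℝ} (hr : 0 ≤ r) :
    psi θ (EuclideanSpace.single i r) = r ^ 2 := by
  have h : ∀ k ∈ Finset.univ, k ≠ i → |EuclideanSpace.single i r k| ^ θ = 0 := by
    intro k _ hk
    simp [hk, Real.zero_rpow hθ.ne']
  rw [psi, Finset.sum_eq_single i h (by simp)]
  simp only [PiLp.single_apply, if_true, abs_of_nonneg hr]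
  rw [← Real.rpow_mul hr, mul_div_cancel₀ _ hθ.ne', Real.rpow_two]

theorem aestronglyMeasurable_psi_mul (hθ : 0 < θ) (ha : 0 ≤ a) (x : L2 d) :
    AEStronglyMeasurable (fun ξ : RSpace d => ((psi θ ξ ^ a : ℝ) : ℂ) * fourierF x ξ) volume :=
  (Complex.continuous_ofReal.comp (continuous_psi_rpow hθ ha)).aestronglyMeasurable.mul
    (memLp_fourierF x).1

theorem norm_psi_mul (z : ℂ) (ξ : RSpace d) :
    ‖((psi θ ξ ^ a : ℝ) : ℂ) * z‖ = psi θ ξ ^ a * ‖z‖ := by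
  rw [norm_mul, Complex.norm_real, Real.norm_of_nonneg (Real.rpow_nonneg (psi_nonneg ξ) _)]

theorem fourierF_Lam {x : L2 d} (hx : InDomain θ a x) :
    fourierF (Lam θ a x) =ᵐ[volume] fun ξ => ((psi θ ξ ^ a : ℝ) : ℂ) * fourierF x ξ :=
  fourierF_fourierFInv hx

theorem norm_fourierF_Lam {x : L2 d} (hx : InDomain θ a x) :
    ∀ᵐ ξ, ‖fourierF (Lam θ a x) ξ‖ = psi θ ξ ^ a * ‖fourierF x ξ‖ := by
  filter_upwards [fourierF_Lam hx] with ξ h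
  rw [h, norm_psi_mul]

theorem InDomain.neg {x : L2 d} (hx : InDomain θ a x) : InDomain θ a (-x) := by
  refine (MemLp.neg hx).ae_eq ?_
  filter_upwards [fourierF_neg x] with ξ h
  simp [h]

theorem Lam_neg {x : L2 d} (hx : InDomain θ a x) : Lam θ a (-x) = -Lam θ a x := by
  apply eq_of_fourierF_ae_eq
  filter_upwards [fourierF_Lam hx, fourierF_Lam hx.neg, fourierF_neg x,
    fourierF_neg (Lam θ a x)] with ξ h1 h2 h3 h4
  rw [h2, h4, h1, h3]
  ring

theorem fracLaplacian_eq_Lam : fracLaplacian (d := d) a = Lam 2 a := by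
  unfold fracLaplacian Lam
  congr 1
  funext ξ
  have h : psi 2 ξ = ‖ξ‖ ^ (2 : ℝ) := by
    rw [psi, div_self two_ne_zero, Real.rpow_one, Real.rpow_two, EuclideanSpace.norm_sq_eq]
    simp
  rw [h, ← Real.rpow_mul (norm_nonneg _)]

/-- The weighted inequality between the arithmetic and the geometric mean, for powers of `p`. -/
theorem rpow_sq_le_weighted {p a b ρ₁ ρ₂ t : ℝ} (hp : 0 ≤ p) (ha : 0 ≤ a) (hb : 0 ≤ b)
    (h₁ : 0 < ρ₁) (h₂ : 0 < ρ₂) (ht : 0 ≤ t) (ht' : t ≤ 1) :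
    (p ^ (t * a + (1 - t) * b)) ^ 2 ≤ (ρ₁ ^ t * ρ₂ ^ (1 - t)) ^ 2 *
      (t / ρ₁ ^ 2 * (p ^ a) ^ 2 + (1 - t) / ρ₂ ^ 2 * (p ^ b) ^ 2) := by
  have hs : 0 ≤ 1 - t := by linarith
  have hq₁ : 0 ≤ p ^ a / ρ₁ := by positivity
  have hq₂ : 0 ≤ p ^ b / ρ₂ := by positivity
  have h := Real.geom_mean_le_arith_mean2_weighted ht hs (sq_nonneg (p ^ a / ρ₁))
    (sq_nonneg (p ^ b / ρ₂)) (by ring)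
  have e : ρ₁ ^ t * ρ₂ ^ (1 - t) * ((p ^ a / ρ₁) ^ t * (p ^ b / ρ₂) ^ (1 - t))
      = p ^ (t * a + (1 - t) * b) := by
    rw [Real.div_rpow (by positivity) h₁.le, Real.div_rpow (by positivity) h₂.le,
      ← Real.rpow_mul hp, ← Real.rpow_mul hp,
      Real.rpow_add_of_nonneg hp (by positivity) (by positivity), mul_comm a, mul_comm b]
    field_simp
  have e' : ((p ^ a / ρ₁) ^ 2) ^ t * ((p ^ b / ρ₂) ^ 2) ^ (1 - t)
      = ((p ^ a / ρ₁) ^ t * (p ^ b / ρ₂) ^ (1 - t)) ^ 2 := by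
    rw [mul_pow, ← Real.rpow_natCast_mul hq₁, ← Real.rpow_natCast_mul hq₂,
      ← Real.rpow_mul_natCast hq₁, ← Real.rpow_mul_natCast hq₂, mul_comm t, mul_comm (1 - t)]
  rw [e'] at h
  rw [← e, mul_pow]
  refine mul_le_mul_of_nonneg_left (h.trans_eq ?_) (sq_nonneg _)
  rw [div_pow, div_pow]
  ring

/-- The weighted inequality of means bounds the intermediate power of `ψ_θ` by the sum of the two
outer ones. -/
theorem inDomain_comb {b t : ℝ} (hθ : 0 < θ) (ha : 0 ≤ a) (hb : 0 ≤ b) (ht : 0 ≤ t) (ht' : t ≤ 1)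
    {x : L2 d} (hx : InDomain θ a x) (hx' : InDomain θ b x) :
    InDomain θ (t * a + (1 - t) * b) x := by
  have hs : 0 ≤ 1 - t := by linarith
  have hsum : MemLp (fun ξ => psi θ ξ ^ a * ‖fourierF x ξ‖ + psi θ ξ ^ b * ‖fourierF x ξ‖) 2
      volume := by
    have h := MemLp.add (MemLp.norm hx) (MemLp.norm hx')
    simp only [norm_psi_mul] at h
    exact h
  refine MemLp.of_le hsum (aestronglyMeasurable_psi_mul hθ (by positivity) x)
    (ae_of_all _ fun ξ => ?_)
  have hp : 0 ≤ psi θ ξ := psi_nonneg ξ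
  have h := Real.geom_mean_le_arith_mean2_weighted ht hs (Real.rpow_nonneg hp a)
    (Real.rpow_nonneg hp b) (by ring)
  rw [← Real.rpow_mul hp, ← Real.rpow_mul hp, ← Real.rpow_add_of_nonneg hp (by positivity)
    (by positivity), mul_comm a, mul_comm b] at h
  have hA := Real.rpow_nonneg hp a
  have hB := Real.rpow_nonneg hp b
  have h' : psi θ ξ ^ (t * a + (1 - t) * b) ≤ psi θ ξ ^ a + psi θ ξ ^ b := by nlinarith
  rw [norm_psi_mul, Real.norm_of_nonneg (by positivity), ← add_mul]
  exact mul_le_mul_of_nonneg_right h' (norm_nonneg _)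

/-- The interpolation inequality. -/
theorem norm_Lam_comb_le {b t : ℝ} (ha : 0 ≤ a) (hb : 0 ≤ b) (ht : 0 < t)
    (ht' : t < 1) {x : L2 d} (hx : InDomain θ a x) (hx' : InDomain θ b x)
    (hx₀ : InDomain θ (t * a + (1 - t) * b) x) :
    ‖Lam θ (t * a + (1 - t) * b) x‖ ≤ ‖Lam θ a x‖ ^ t * ‖Lam θ b x‖ ^ (1 - t) := by
  have hs : 0 < 1 - t := by linarith
  set r₁ := ‖Lam θ a x‖ with hr₁
  set r₂ := ‖Lam θ b x‖ with hr₂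
  have hn₁ : 0 ≤ r₁ := norm_nonneg _
  have hn₂ : 0 ≤ r₂ := norm_nonneg _
  -- Either norm may vanish, while the weights `t / ρ₁²` and `(1 - t) / ρ₂²` need positive `ρ`.
  -- Hence both are shifted by `ε`, which then tends to `0`.
  have key : ∀ ε : ℝ, 0 < ε →
      ‖Lam θ (t * a + (1 - t) * b) x‖ ≤ (r₁ + ε) ^ t * (r₂ + ε) ^ (1 - t) := by
    intro ε hε
    have h₁ : 0 < r₁ + ε := by positivity
    have h₂ : 0 < r₂ + ε := by positivity
    set K := (r₁ + ε) ^ t * (r₂ + ε) ^ (1 - t) with hK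
    have hsq := norm_sq_le_of_ae_le (z := Lam θ (t * a + (1 - t) * b) x) (u := Lam θ a x)
      (v := Lam θ b x) (b₁ := K ^ 2 * (t / (r₁ + ε) ^ 2)) (b₂ := K ^ 2 * ((1 - t) / (r₂ + ε) ^ 2))
      (by
        filter_upwards [norm_fourierF_Lam hx, norm_fourierF_Lam hx', norm_fourierF_Lam hx₀]
          with ξ e₁ e₂ e₀
        rw [e₁, e₂, e₀, mul_pow, mul_pow, mul_pow]
        have := mul_le_mul_of_nonneg_right (rpow_sq_le_weighted (psi_nonneg (θ := θ) ξ) ha hb h₁ h₂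
          ht.le ht'.le) (sq_nonneg ‖fourierF x ξ‖)
        linarith)
    rw [← hr₁, ← hr₂] at hsq
    have q₁ : r₁ ^ 2 / (r₁ + ε) ^ 2 ≤ 1 := by
      rw [div_le_one (by positivity)]
      exact pow_le_pow_left₀ hn₁ (by linarith) 2
    have q₂ : r₂ ^ 2 / (r₂ + ε) ^ 2 ≤ 1 := by
      rw [div_le_one (by positivity)]
      exact pow_le_pow_left₀ hn₂ (by linarith) 2
    have hc : t * (r₁ ^ 2 / (r₁ + ε) ^ 2) + (1 - t) * (r₂ ^ 2 / (r₂ + ε) ^ 2) ≤ 1 := by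
      nlinarith
    refine le_of_sq_le_sq ?_ (by positivity)
    calc _ ≤ _ := hsq
      _ = K ^ 2 * (t * (r₁ ^ 2 / (r₁ + ε) ^ 2) + (1 - t) * (r₂ ^ 2 / (r₂ + ε) ^ 2)) := by ring
      _ ≤ K ^ 2 * 1 := mul_le_mul_of_nonneg_left hc (sq_nonneg _)
      _ = K ^ 2 := mul_one _
  have hcont : Continuous fun ε : ℝ => (r₁ + ε) ^ t * (r₂ + ε) ^ (1 - t) :=
    (Continuous.rpow_const (by fun_prop) fun _ => Or.inr ht.le).mul
      (Continuous.rpow_const (by fun_prop) fun _ => Or.inr hs.le)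
  have hlim := (hcont.tendsto 0).mono_left (nhdsWithin_le_nhds (s := Set.Ioi 0))
  simp only [add_zero] at hlim
  exact ge_of_tendsto hlim (by filter_upwards [self_mem_nhdsWithin] with ε hε using key ε hε)

/-- On a coordinate axis `ψ_θ` equals `r²`, so it takes values just below `e^s`. Staying below `e^s`
makes `ψ_θ^a ≤ e^{sa}` available for all `a ≥ 0` at once, and continuity preserves the strict
inequality with `B`. -/
theorem exists_psi_lt_and_lt (hd : 0 < d) (hθ : 0 < θ) {a₀ s A B : ℝ} (ha₀ : 0 ≤ a₀)
    (hB : B < A * Real.exp (s * a₀)) :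
    ∃ ξ₀ : RSpace d, psi θ ξ₀ < Real.exp s ∧ B < A * psi θ ξ₀ ^ a₀ := by
  have hcont : Continuous fun r : ℝ => A * (r ^ 2) ^ a₀ :=
    continuous_const.mul (Continuous.rpow_const (by fun_prop) fun _ => Or.inr ha₀)
  have he : Real.exp (s / 2) ^ 2 = Real.exp s := by
    rw [← Real.exp_nat_mul]; congr 1; push_cast; ring
  have hev : ∀ᶠ r in nhdsWithin (Real.exp (s / 2)) (Set.Iio (Real.exp (s / 2))),
      B < A * (r ^ 2) ^ a₀ := by
    refine ((hcont.tendsto _).mono_left nhdsWithin_le_nhds).eventually_const_lt ?_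
    rw [he, ← Real.exp_mul]
    exact hB
  have hpos : ∀ᶠ r in nhdsWithin (Real.exp (s / 2)) (Set.Iio (Real.exp (s / 2))), 0 < r :=
    nhdsWithin_le_nhds (lt_mem_nhds (Real.exp_pos _))
  obtain ⟨r, ⟨hr, hr0⟩, hr1⟩ := ((hev.and hpos).and self_mem_nhdsWithin).exists
  refine ⟨EuclideanSpace.single ⟨0, hd⟩ r, ?_, ?_⟩
  · rw [psi_single hθ _ hr0.le, ← he]
    exact pow_lt_pow_left₀ hr1 hr0.le two_ne_zero
  · rwa [psi_single hθ _ hr0.le]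

/-- A function whose Fourier transform is constant on `U` and zero outside of `U`. -/
theorem exists_norm_Lam_sq_eq_setIntegral (hθ : 0 < θ) {U : Set (RSpace d)} (hUm : MeasurableSet U)
    (hUfin : volume U ≠ ⊤) (hUpos : 0 < volume.real U) {R : ℝ} (hR : ∀ ξ ∈ U, psi θ ξ ≤ R)
    (A : ℝ) :
    ∃ x : L2 d, (∀ a, 0 ≤ a → InDomain θ a x) ∧ ∀ a, 0 ≤ a →
      ‖Lam θ a x‖ ^ 2 = A ^ 2 / volume.real U * ∫ ξ in U, (psi θ ξ ^ a) ^ 2 := by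
  -- The height that gives the function the norm `|A|`, once the Plancherel factor and the volume of
  -- `U` are accounted for.
  set k : ℝ := A * √((2 * Real.pi) ^ d / volume.real U) with hk
  have hk2 : ((2 * Real.pi) ^ d)⁻¹ * k ^ 2 = A ^ 2 / volume.real U := by
    rw [hk, mul_pow A, Real.sq_sqrt (by positivity)]
    field_simp
  have hgL : MemLp (U.indicator fun _ => (k : ℂ)) 2 volume :=
    memLp_indicator_const 2 hUm _ (Or.inr hUfin)
  obtain ⟨x, hx⟩ : ∃ x : L2 d, fourierF x =ᵐ[volume] U.indicator fun _ => (k : ℂ) :=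
    ⟨_, fourierF_fourierFInv hgL⟩
  have hdom : ∀ a, 0 ≤ a → InDomain θ a x := by
    intro a ha
    refine MemLp.of_le_mul (c := R ^ a) hgL (aestronglyMeasurable_psi_mul hθ ha x) ?_
    filter_upwards [hx] with ξ hξ
    rw [hξ, norm_psi_mul]
    by_cases h : ξ ∈ U
    · exact mul_le_mul_of_nonneg_right (Real.rpow_le_rpow (psi_nonneg ξ) (hR ξ h) ha)
        (norm_nonneg _)
    · simp [h]
  refine ⟨x, hdom, fun a ha => ?_⟩
  have hI : ∫ ξ, ‖fourierF (Lam θ a x) ξ‖ ^ 2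
      = ∫ ξ, k ^ 2 * U.indicator (fun ξ => (psi θ ξ ^ a) ^ 2) ξ := ?_
  · rw [norm_sq_eq_integral_fourierF, hI, ← hk2, integral_const_mul, integral_indicator hUm,
      mul_assoc]
  refine integral_congr_ae ?_
  filter_upwards [norm_fourierF_Lam (hdom a ha), hx] with ξ e1 e2
  rw [e1, e2]
  by_cases h : ξ ∈ U
  · simp [h, mul_pow, mul_comm]
  · simp [h]

/-- Functions whose Fourier transform is concentrated near the level set `ψ_θ = e^s`. -/
theorem exists_norm_Lam_le_and_le (hd : 0 < d) (hθ : 0 < θ) {a₀ s A B : ℝ} (ha₀ : 0 ≤ a₀)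
    (hA : 0 < A) (hB : B < A * Real.exp (s * a₀)) :
    ∃ x : L2 d, (∀ a, 0 ≤ a → InDomain θ a x) ∧
      (∀ a, 0 ≤ a → ‖Lam θ a x‖ ≤ A * Real.exp (s * a)) ∧ B ≤ ‖Lam θ a₀ x‖ := by
  obtain ⟨ξ₀, h1, h2⟩ := exists_psi_lt_and_lt hd hθ ha₀ hB
  obtain ⟨U, hUψ, hUB, hUo, hξ₀, hUfin⟩ : ∃ U : Set (RSpace d), (∀ ξ ∈ U, psi θ ξ ≤ Real.exp s) ∧
      (∀ ξ ∈ U, B ≤ A * psi θ ξ ^ a₀) ∧ IsOpen U ∧ ξ₀ ∈ U ∧ volume U ≠ ⊤ :=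
    -- The ball only serves to make the measure finite; openness and the point `ξ₀` make it
    -- positive.
    ⟨({ξ | psi θ ξ < Real.exp s} ∩ {ξ | B < A * psi θ ξ ^ a₀}) ∩ Metric.ball ξ₀ 1,
      fun ξ h => h.1.1.le, fun ξ h => h.1.2.le,
      ((isOpen_lt (continuous_psi hθ) continuous_const).inter (isOpen_lt continuous_const
        (continuous_const.mul (continuous_psi_rpow hθ ha₀)))).inter Metric.isOpen_ball,
      ⟨⟨h1, h2⟩, Metric.mem_ball_self one_pos⟩,
      ((measure_mono Set.inter_subset_right).trans_lt measure_ball_lt_top).ne⟩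
  have hUm : MeasurableSet U := hUo.measurableSet
  have hUpos : 0 < volume.real U := ENNReal.toReal_pos (hUo.measure_pos volume ⟨ξ₀, hξ₀⟩).ne' hUfin
  obtain ⟨x, hdom, hnorm⟩ := exists_norm_Lam_sq_eq_setIntegral hθ hUm hUfin hUpos hUψ A
  have hψ : ∀ a : ℝ, 0 ≤ a → ∀ ξ ∈ U, (psi θ ξ ^ a) ^ 2 ≤ Real.exp (s * a) ^ 2 := by
    intro a ha ξ hξ
    rw [Real.exp_mul]
    exact pow_le_pow_left₀ (Real.rpow_nonneg (psi_nonneg ξ) _)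
      (Real.rpow_le_rpow (psi_nonneg ξ) (hUψ ξ hξ) ha) 2
  have hint : ∀ a : ℝ, 0 ≤ a → IntegrableOn (fun ξ => (psi θ ξ ^ a) ^ 2) U := by
    intro a ha
    have hc : Continuous fun ξ : RSpace d => (psi θ ξ ^ a) ^ 2 := (continuous_psi_rpow hθ ha).pow 2
    refine Measure.integrableOn_of_bounded (M := Real.exp (s * a) ^ 2) hUfin
      hc.aestronglyMeasurable ?_
    filter_upwards [ae_restrict_mem hUm] with ξ hξ
    rw [Real.norm_of_nonneg (sq_nonneg _)]
    exact hψ a ha ξ hξ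
  have hC : 0 ≤ A ^ 2 / volume.real U := by positivity
  refine ⟨x, hdom, fun a ha => ?_, ?_⟩
  · refine le_of_sq_le_sq ?_ (by positivity)
    have hm := setIntegral_mono_on (hint a ha) (integrableOn_const hUfin) hUm (hψ a ha)
    rw [setIntegral_const, smul_eq_mul] at hm
    calc _ = _ := hnorm a ha
      _ ≤ _ := mul_le_mul_of_nonneg_left hm hC
      _ = _ := by field_simp
  · rcases lt_or_ge B 0 with hB0 | hB0
    · exact hB0.le.trans (norm_nonneg _)
    refine le_of_sq_le_sq ?_ (norm_nonneg _)
    have hm := setIntegral_mono_on (f := fun _ => (B / A) ^ 2) (integrableOn_const hUfin)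
      (hint a₀ ha₀) hUm (fun ξ hξ => pow_le_pow_left₀ (by positivity)
        ((div_le_iff₀' hA).2 (hUB ξ hξ)) 2)
    rw [setIntegral_const, smul_eq_mul] at hm
    calc B ^ 2 = A ^ 2 / volume.real U * (volume.real U * (B / A) ^ 2) := by field_simp
      _ ≤ _ := mul_le_mul_of_nonneg_left hm hC
      _ = _ := (hnorm a₀ ha₀).symm

end Lam

/-! ### Support lines -/

section Support

variable {N : ℕ} {α δ : Fin N → ℝ} {a₀ η c t : ℝ} {j₁ j₂ : Fin N}

theorem hullQ_le_line (h : ∀ k, Real.log (1 / δ k) ≤ η * α k + c) {q : ℝ × ℝ}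
    (hq : q ∈ hullQ α δ) : q.2 ≤ η * q.1 + c := by
  have hconv : Convex ℝ {q : ℝ × ℝ | q.2 ≤ η * q.1 + c} := by
    intro p hp q hq u v hu hv huv
    simp only [Set.mem_ofPred_eq, Prod.snd_add, Prod.smul_snd, smul_eq_mul, Prod.fst_add,
      Prod.smul_fst] at hp hq ⊢
    have hc : c = u * c + v * c := by rw [← add_mul, huv, one_mul]
    nlinarith [mul_le_mul_of_nonneg_left hp hu, mul_le_mul_of_nonneg_left hq hv]
  exact convexHull_min (by rintro _ ⟨k, rfl⟩; exact h k) hconv hq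

/-- Each node lies below `S`, hence below the line. This makes the extremal functions satisfy all
`N` constraints, not only those with indices `j₁`, `j₂`. -/
theorem IsSupportPair.le_line (h : IsSupportPair α δ a₀ η c j₁ j₂ t) (k : Fin N) :
    Real.log (1 / δ k) ≤ η * α k + c := by
  have hk : α k ∈ convexHull ℝ (Set.range α) := subset_convexHull ℝ _ ⟨k, rfl⟩
  have hQ : (α k, Real.log (1 / δ k)) ∈ hullQ α δ := subset_convexHull ℝ _ ⟨k, rfl⟩
  exact ((broken_isGreatest α δ hk).2 hQ).trans (h.support _ hk)

/-- An affine function takes at `a₀` the `t`-weighted mean of its values at `α j₁` and `α j₂`, which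
are `-ln δ`. -/
theorem IsSupportPair.exp_neg_broken (hδ : ∀ j, 0 < δ j) (h : IsSupportPair α δ a₀ η c j₁ j₂ t) :
    Real.exp (-broken α δ a₀) = δ j₁ ^ t * δ j₂ ^ (1 - t) := by
  have h₁ := h.mem₁
  have h₂ := h.mem₂
  rw [one_div, Real.log_inv] at h₁ h₂
  rw [Real.rpow_def_of_pos (hδ _), Real.rpow_def_of_pos (hδ _), ← Real.exp_add, h.touch, h.comb]
  congr 1
  linear_combination t * h₁ + (1 - t) * h₂

theorem IsSupportPair.ne (ha₀ : a₀ ∉ Set.range α) (h : IsSupportPair α δ a₀ η c j₁ j₂ t) :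
    α j₁ ≠ α j₂ := by
  intro e
  exact ha₀ ⟨j₂, by rw [h.comb, e]; ring⟩

/-- Among the finitely many chords joining a node on the left of `a₀` to one on the right, take the
one that is highest over `a₀`. A node above its line could replace the endpoint on its own side and
give a higher chord. -/
theorem exists_isSupportPair (ha₀ : a₀ ∈ convexHull ℝ (Set.range α)) (ha₀' : a₀ ∉ Set.range α) :
    ∃ (η c : ℝ) (j₁ j₂ : Fin N) (t : ℝ), IsSupportPair α δ a₀ η c j₁ j₂ t := by
  have hne : ∀ k, α k ≠ a₀ := fun k hk => ha₀' ⟨k, hk⟩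
  obtain ⟨i₀, hi₀⟩ : ∃ i, α i < a₀ := by
    by_contra! hcon
    have : convexHull ℝ (Set.range α) ⊆ Set.Ioi a₀ := convexHull_min
      (by rintro _ ⟨k, rfl⟩; exact lt_of_le_of_ne (hcon k) (hne k).symm) (convex_Ioi _)
    exact lt_irrefl a₀ (this ha₀)
  obtain ⟨k₀, hk₀⟩ : ∃ k, a₀ < α k := by
    by_contra! hcon
    have : convexHull ℝ (Set.range α) ⊆ Set.Iio a₀ := convexHull_min
      (by rintro _ ⟨k, rfl⟩; exact lt_of_le_of_ne (hcon k) (hne k)) (convex_Iio _)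
    exact lt_irrefl a₀ (this ha₀)
  set p : Fin N → ℝ := fun k => Real.log (1 / δ k) with hp
  -- the value at `a₀` of the line through the points with the indices `q.1` and `q.2`
  let v : Fin N × Fin N → ℝ := fun q =>
    ((α q.2 - a₀) * p q.1 + (a₀ - α q.1) * p q.2) / (α q.2 - α q.1)
  obtain ⟨⟨i, j⟩, hij, hmax⟩ := Finset.exists_max_image
    (Finset.univ.filter fun q : Fin N × Fin N => α q.1 < a₀ ∧ a₀ < α q.2) v
    ⟨(i₀, k₀), by simp [hi₀, hk₀]⟩
  simp only [Finset.mem_filter, Finset.mem_univ, true_and] at hij hmax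
  obtain ⟨hi, hj⟩ := hij
  have hD : 0 < α j - α i := by linarith
  set η := (p j - p i) / (α j - α i) with hη
  set c := p i - η * α i with hc
  have hηD : η * (α j - α i) = p j - p i := by rw [hη]; field_simp
  have hvij : v (i, j) = η * a₀ + c := by
    simp only [v]
    rw [div_eq_iff hD.ne', hc]
    linear_combination (-a₀ + α i) * hηD
  have hline : ∀ k, p k ≤ η * α k + c := by
    intro k
    rcases lt_or_gt_of_ne (hne k) with hk | hk
    · have hm := hmax (k, j) ⟨hk, hj⟩
      have hDk : 0 < α j - α k := by linarith
      rw [hvij] at hm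
      simp only [v] at hm
      rw [div_le_iff₀ hDk] at hm
      have hpj : p j = η * α j + c := by rw [hc]; linarith
      rw [hpj] at hm
      have : (α j - a₀) * p k ≤ (α j - a₀) * (η * α k + c) := by linarith
      exact le_of_mul_le_mul_left this (by linarith)
    · have hm := hmax (i, k) ⟨hi, hk⟩
      have hDk : 0 < α k - α i := by linarith
      rw [hvij] at hm
      simp only [v] at hm
      rw [div_le_iff₀ hDk] at hm
      have hpi : p i = η * α i + c := by rw [hc]; ring
      rw [hpi] at hm
      have : (a₀ - α i) * p k ≤ (a₀ - α i) * (η * α k + c) := by linarith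
      exact le_of_mul_le_mul_left this (by linarith)
  have hsupp : ∀ a ∈ convexHull ℝ (Set.range α), broken α δ a ≤ η * a + c := fun a ha =>
    hullQ_le_line hline (broken_isGreatest α δ ha).1
  set t := (α j - a₀) / (α j - α i) with ht
  have htD : t * (α j - α i) = α j - a₀ := by rw [ht]; field_simp
  have ht0 : 0 < t := div_pos (by linarith) hD
  have ht1 : t < 1 := by rw [ht, div_lt_one hD]; linarith
  have hcomb : a₀ = t * α i + (1 - t) * α j := by linarith
  refine ⟨η, c, i, j, t, hsupp, le_antisymm (hsupp _ ha₀) ?_, ?_, ?_, ht0, ht1, hcomb⟩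
  -- The point of the chord over `a₀` belongs to the hull, so `S(a₀)` is at least its height.
  · refine (broken_isGreatest α δ ha₀).2 ?_
    have hQ := convex_convexHull ℝ (Set.range fun j => (α j, Real.log (1 / δ j)))
      (subset_convexHull ℝ _ ⟨i, rfl⟩) (subset_convexHull ℝ _ ⟨j, rfl⟩) ht0.le
      (by linarith : (0 : ℝ) ≤ 1 - t) (by ring)
    have e : (a₀, η * a₀ + c) = t • (α i, p i) + (1 - t) • (α j, p j) := by
      ext
      · simpa using hcomb
      · simp only [Prod.snd_add, Prod.smul_snd, smul_eq_mul, hc]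
        linear_combination η * hcomb + (1 - t) * hηD
    simpa only [Set.mem_ofPred_eq, hullQ, e] using hQ
  · change p i = _
    rw [hc]; ring
  · change p j = _
    rw [hc]; linarith

end Support

/-! ### Exactness of the interpolation inequality -/

/-- Two positive norms at distinct exponents fit a unique exponential `A e^{sa}`. Functions
concentrated near `ψ_θ = e^s` respect both norms and come arbitrarily close to its value at the
intermediate exponent, which is the right-hand side. -/
theorem isExactInequality_Lam {d N : ℕ} (hd : 0 < d) {θ : ℝ} (hθ : 0 < θ) {α : Fin N → ℝ}
    (hα : ∀ j, 0 ≤ α j) {j₁ j₂ : Fin N} (hne : α j₁ ≠ α j₂) {t : ℝ} (ht : 0 < t) (ht' : t < 1) :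
    IsExactInequality (functionSpace (d := d) θ α) (Lam θ (t * α j₁ + (1 - t) * α j₂))
      ![Lam θ (α j₁), Lam θ (α j₂)] (fun r => r 0 ^ t * r 1 ^ (1 - t)) := by
  have hs : 0 < 1 - t := by linarith
  have ha₀ : 0 ≤ t * α j₁ + (1 - t) * α j₂ :=
    add_nonneg (mul_nonneg ht.le (hα _)) (mul_nonneg hs.le (hα _))
  refine ⟨fun x hx => norm_Lam_comb_le (hα j₁) (hα j₂) ht ht' (hx j₁) (hx j₂)
    (inDomain_comb hθ (hα j₁) (hα j₂) ht.le ht'.le (hx j₁) (hx j₂)), ?_⟩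
  rintro ⟨x₀, hx₀, hlt⟩
  simp only [Matrix.cons_val_zero, Matrix.cons_val_one] at hlt
  set r₁ := ‖Lam θ (α j₁) x₀‖ with hr₁
  set r₂ := ‖Lam θ (α j₂) x₀‖ with hr₂
  obtain ⟨b, hb, hb'⟩ := exists_between hlt
  have hbtop : b ≠ ⊤ := hb'.ne_top
  have hbκ : b.toReal < r₁ ^ t * r₂ ^ (1 - t) := by
    rwa [← ENNReal.ofReal_toReal hbtop, ENNReal.ofReal_lt_ofReal_iff_of_nonneg
      ENNReal.toReal_nonneg] at hb'
  have hκ : 0 < r₁ ^ t * r₂ ^ (1 - t) := ENNReal.toReal_nonneg.trans_lt hbκ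
  have h₁ : 0 < r₁ := by
    rcases (norm_nonneg (Lam θ (α j₁) x₀)).eq_or_lt with h | h
    · rw [hr₁, ← h, Real.zero_rpow ht.ne', zero_mul] at hκ
      exact absurd hκ (lt_irrefl _)
    · exact h
  have h₂ : 0 < r₂ := by
    rcases (norm_nonneg (Lam θ (α j₂) x₀)).eq_or_lt with h | h
    · rw [hr₂, ← h, Real.zero_rpow hs.ne', mul_zero] at hκ
      exact absurd hκ (lt_irrefl _)
    · exact h
  -- `a ↦ L + s a` is the line through `(α j₁, log r₁)` and `(α j₂, log r₂)`.
  set s := (Real.log r₁ - Real.log r₂) / (α j₁ - α j₂) with hs_def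
  have hsD : s * (α j₁ - α j₂) = Real.log r₁ - Real.log r₂ :=
    div_mul_cancel₀ _ (sub_ne_zero.2 hne)
  set L := Real.log r₁ - s * α j₁ with hL
  have e₁ : Real.exp L * Real.exp (s * α j₁) = r₁ := by
    rw [← Real.exp_add, hL, sub_add_cancel, Real.exp_log h₁]
  have e₂ : Real.exp L * Real.exp (s * α j₂) = r₂ := by
    rw [← Real.exp_add, ← Real.exp_log h₂]
    congr 1
    rw [hL]; linarith
  have e₀ : Real.exp L * Real.exp (s * (t * α j₁ + (1 - t) * α j₂)) = r₁ ^ t * r₂ ^ (1 - t) := by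
    rw [Real.rpow_def_of_pos h₁, Real.rpow_def_of_pos h₂, ← Real.exp_add, ← Real.exp_add]
    congr 1
    rw [hL]
    linear_combination (-(1 - t)) * hsD
  obtain ⟨x, hdom, hle, hge⟩ := exists_norm_Lam_le_and_le hd hθ ha₀ (Real.exp_pos L)
    (hbκ.trans_eq e₀.symm)
  refine hb.not_ge ?_
  refine le_trans ?_ (le_iSup₂_of_le x (fun j => hdom _ (hα j)) (le_iSup_of_le ?_ le_rfl))
  · rw [← ENNReal.ofReal_toReal hbtop, ← ofReal_norm]
    exact ENNReal.ofReal_le_ofReal hge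
  · intro i
    fin_cases i
    · exact (hle _ (hα j₁)).trans_eq e₁
    · exact (hle _ (hα j₂)).trans_eq e₂

/-! ### Optimal recovery -/

section Recovery

variable {d N m : ℕ} {θ : ℝ} {α δ : Fin N → ℝ} {a₀ η c t : ℝ} {j₁ j₂ : Fin N}

theorem IsSupportPair.inDomain (hθ : 0 < θ) (hα : ∀ j, 0 ≤ α j)
    (h : IsSupportPair α δ a₀ η c j₁ j₂ t) {x : L2 d} (hx : x ∈ functionSpace θ α) :
    InDomain θ a₀ x := by
  rw [h.comb]
  exact inDomain_comb hθ (hα j₁) (hα j₂) h.pos.le h.lt_one.le (hx j₁) (hx j₂)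

/-- For each `ξ` with `D ξ > 0`, minimise the quadratic form under the linear constraint. The
minimiser is `a_j = ψ^{a₀} w_j ψ^{α_j} / D` and the minimum is `ψ^{2a₀} / D`, which the weighted
inequality of means bounds by `e^{-2S(a₀)}`. -/
theorem IsSupportPair.exists_isAdmissible (hθ : 0 < θ) (hα : ∀ j, 0 ≤ α j) (hδ : ∀ j, 0 < δ j)
    (h : IsSupportPair α δ a₀ η c j₁ j₂ t) (hne : j₁ ≠ j₂) :
    ∃ a : Fin N → RSpace d → ℂ, IsAdmissible θ α δ a₀ j₁ j₂ t a := by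
  have ht := h.pos
  have hs : 0 < 1 - t := by linarith [h.lt_one]
  have h₁ := hδ j₁
  have h₂ := hδ j₂
  have ha₀ : 0 ≤ a₀ := by
    rw [h.comb]
    exact add_nonneg (mul_nonneg ht.le (hα _)) (mul_nonneg hs.le (hα _))
  set w₁ := t / δ j₁ ^ 2 with hw₁
  set w₂ := (1 - t) / δ j₂ ^ 2 with hw₂
  have hw₁p : 0 < w₁ := by positivity
  have hw₂p : 0 < w₂ := by positivity
  set D : RSpace d → ℝ := fun ξ => w₁ * (psi θ ξ ^ α j₁) ^ 2 + w₂ * (psi θ ξ ^ α j₂) ^ 2 with hD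
  set E := Real.exp (-2 * broken α δ a₀) with hE
  have hEeq : E = (δ j₁ ^ t * δ j₂ ^ (1 - t)) ^ 2 := by
    rw [← h.exp_neg_broken hδ, ← Real.exp_nat_mul, hE]
    congr 1
    push_cast; ring
  have hkey : ∀ ξ, (psi θ ξ ^ a₀) ^ 2 ≤ E * D ξ := by
    intro ξ
    rw [hEeq, h.comb]
    exact rpow_sq_le_weighted (psi_nonneg ξ) (hα _) (hα _) h₁ h₂ ht.le h.lt_one.le
  have hD0 : ∀ ξ, 0 ≤ D ξ := fun ξ => by positivity
  let a : Fin N → RSpace d → ℝ := fun j ξ =>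
    psi θ ξ ^ a₀ * ((if j = j₁ then w₁ else w₂) * psi θ ξ ^ α j) / D ξ
  have hmeas : ∀ j, AEStronglyMeasurable (fun ξ => ((a j ξ : ℝ) : ℂ)) volume := by
    intro j
    have hc : ∀ b : ℝ, 0 ≤ b → Measurable fun ξ : RSpace d => psi θ ξ ^ b :=
      fun b hb => (continuous_psi_rpow hθ hb).measurable
    have hDm : Measurable D :=
      (((hc _ (hα j₁)).pow_const 2).const_mul w₁).add (((hc _ (hα j₂)).pow_const 2).const_mul w₂)
    exact (Complex.measurable_ofReal.comp
      (((hc _ ha₀).mul ((hc _ (hα j)).const_mul _)).div hDm)).aestronglyMeasurable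
  have e₁ : ∀ ξ, a j₁ ξ = psi θ ξ ^ a₀ * (w₁ * psi θ ξ ^ α j₁) / D ξ := by
    intro ξ; simp [a]
  have e₂ : ∀ ξ, a j₂ ξ = psi θ ξ ^ a₀ * (w₂ * psi θ ξ ^ α j₂) / D ξ := by
    intro ξ; simp [a, hne.symm]
  refine ⟨fun j ξ => (a j ξ : ℂ), hmeas j₁, hmeas j₂, ae_of_all _ fun ξ => ?_,
    ae_of_all _ fun ξ => ?_⟩
  · norm_cast
    rw [e₁, e₂]
    -- If `D ξ = 0`, then `hkey` forces `ψ^{a₀} = 0`, so the value `0` that division by zero gives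
    -- to `a` satisfies the constraint.
    rcases (hD0 ξ).eq_or_lt with h0 | h0
    · have := hkey ξ
      rw [← h0, mul_zero] at this
      have hz : psi θ ξ ^ a₀ = 0 := pow_eq_zero_iff two_ne_zero |>.1 (le_antisymm this (sq_nonneg _))
      simp [hz]
    · calc _ = psi θ ξ ^ a₀ * D ξ / D ξ := by simp only [hD]; ring
        _ = _ := mul_div_cancel_right₀ _ h0.ne'
  · simp only [Complex.norm_real, Real.norm_eq_abs, sq_abs]
    rw [e₁, e₂]
    rcases (hD0 ξ).eq_or_lt with h0 | h0
    · rw [← h0]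
      simpa using (Real.exp_pos _).le
    · have hsum : δ j₁ ^ 2 * (psi θ ξ ^ a₀ * (w₁ * psi θ ξ ^ α j₁) / D ξ) ^ 2 / t +
          δ j₂ ^ 2 * (psi θ ξ ^ a₀ * (w₂ * psi θ ξ ^ α j₂) / D ξ) ^ 2 / (1 - t)
          = (psi θ ξ ^ a₀) ^ 2 * D ξ / D ξ ^ 2 := by
        have q₁ : δ j₁ ^ 2 * w₁ / t = 1 := by rw [hw₁]; field_simp
        have q₂ : δ j₂ ^ 2 * w₂ / (1 - t) = 1 := by rw [hw₂]; field_simp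
        calc _ = (psi θ ξ ^ a₀) ^ 2 * ((δ j₁ ^ 2 * w₁ / t) * (w₁ * (psi θ ξ ^ α j₁) ^ 2) +
              (δ j₂ ^ 2 * w₂ / (1 - t)) * (w₂ * (psi θ ξ ^ α j₂) ^ 2)) / D ξ ^ 2 := by ring_nf
          _ = _ := by rw [q₁, q₂, one_mul, one_mul]
      rw [hsum, div_le_iff₀ (by positivity)]
      calc _ ≤ E * D ξ * D ξ := mul_le_mul_of_nonneg_right (hkey ξ) h0.le
        _ = _ := by ring

/-- The data `y`, extended by zero to all indices. -/
noncomputable def extendData (y : Fin m → L2 d) (k : Fin N) : L2 d :=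
  if h : (k : ℕ) < m then y ⟨k, h⟩ else 0

theorem extendData_castLE (hm : m ≤ N) (y : Fin m → L2 d) (j : Fin m) :
    extendData y (Fin.castLE hm j) = y j := by
  simp [extendData]

/-- Indices outside `M` contribute nothing because their extended data are `0`. The equality is only
almost everywhere because `fourierF 0` vanishes only almost everywhere. -/
theorem methodSymbol_ae_eq (hm : m ≤ N) (hne : j₁ ≠ j₂) (a : Fin N → RSpace d → ℂ)
    (y : Fin m → L2 d) :
    methodSymbol hm j₁ j₂ a y =ᵐ[volume] fun ξ =>
      a j₁ ξ * fourierF (extendData y j₁) ξ + a j₂ ξ * fourierF (extendData y j₂) ξ := by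
  filter_upwards [fourierF_zero (d := d)] with ξ h0
  have hs : (indexM hm j₁ j₂).map (Fin.castLEEmb hm) ⊆ {j₁, j₂} := by
    intro k hk
    simp only [Finset.mem_map, indexM, Finset.mem_filter, Finset.mem_univ, true_and] at hk
    obtain ⟨j, hj, rfl⟩ := hk
    simpa using hj
  rw [← Finset.sum_pair (f := fun k => a k ξ * fourierF (extendData y k) ξ) hne,
    ← Finset.sum_subset hs, Finset.sum_map]
  · simp [methodSymbol, extendData_castLE]
  · intro k hk hk'
    have hkm : ¬ (k : ℕ) < m := by
      intro hlt
      refine hk' (Finset.mem_map.2 ⟨⟨k, hlt⟩, ?_, rfl⟩)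
      simp only [indexM, Finset.mem_filter, Finset.mem_univ, true_and]
      simpa using hk
    simp [extendData, hkm, h0]

/-- The bound on the quadratic form makes `a j₁` and `a j₂` essentially bounded. -/
theorem IsAdmissible.memLp_mul (hδ : ∀ j, 0 < δ j) (ht : 0 < t) (ht' : t < 1)
    {a : Fin N → RSpace d → ℂ} (ha : IsAdmissible θ α δ a₀ j₁ j₂ t a) (x : L2 d) :
    MemLp (fun ξ => a j₁ ξ * fourierF x ξ) 2 volume ∧
      MemLp (fun ξ => a j₂ ξ * fourierF x ξ) 2 volume := by
  have hs : 0 < 1 - t := by linarith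
  have h₁ := hδ j₁
  have h₂ := hδ j₂
  constructor
  · refine MemLp.of_le_mul (c := √(Real.exp (-2 * broken α δ a₀) * t / δ j₁ ^ 2))
      (memLp_fourierF x) (ha.meas₁.mul (memLp_fourierF x).1) ?_
    filter_upwards [ha.le] with ξ hξ
    rw [norm_mul]
    refine mul_le_mul_of_nonneg_right (Real.le_sqrt_of_sq_le ?_) (norm_nonneg _)
    have : 0 ≤ δ j₂ ^ 2 * ‖a j₂ ξ‖ ^ 2 / (1 - t) := by positivity
    rw [le_div_iff₀ (by positivity), ← div_le_iff₀ ht, mul_comm (‖a j₁ ξ‖ ^ 2)]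
    linarith
  · refine MemLp.of_le_mul (c := √(Real.exp (-2 * broken α δ a₀) * (1 - t) / δ j₂ ^ 2))
      (memLp_fourierF x) (ha.meas₂.mul (memLp_fourierF x).1) ?_
    filter_upwards [ha.le] with ξ hξ
    rw [norm_mul]
    refine mul_le_mul_of_nonneg_right (Real.le_sqrt_of_sq_le ?_) (norm_nonneg _)
    have : 0 ≤ δ j₁ ^ 2 * ‖a j₁ ξ‖ ^ 2 / t := by positivity
    rw [le_div_iff₀ (by positivity), ← div_le_iff₀ hs, mul_comm (‖a j₂ ξ‖ ^ 2)]
    linarith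

theorem IsAdmissible.memLp_methodSymbol (hm : m ≤ N) (hδ : ∀ j, 0 < δ j) (ht : 0 < t) (ht' : t < 1)
    (hne : j₁ ≠ j₂) {a : Fin N → RSpace d → ℂ} (ha : IsAdmissible θ α δ a₀ j₁ j₂ t a)
    (y : Fin m → L2 d) : MemLp (methodSymbol hm j₁ j₂ a y) 2 volume :=
  MemLp.ae_eq (methodSymbol_ae_eq hm hne a y).symm
    ((ha.memLp_mul hδ ht ht' _).1.add (ha.memLp_mul hδ ht ht' _).2)

/-- The weighted Cauchy–Schwarz inequality. -/
theorem norm_add_mul_sq_le {a b u v : ℂ} {d₁ d₂ t E : ℝ} (h₁ : 0 < d₁) (h₂ : 0 < d₂) (ht : 0 < t)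
    (ht' : t < 1) (h : d₁ ^ 2 * ‖a‖ ^ 2 / t + d₂ ^ 2 * ‖b‖ ^ 2 / (1 - t) ≤ E) :
    ‖a * u + b * v‖ ^ 2 ≤ E * (t / d₁ ^ 2) * ‖u‖ ^ 2 + E * ((1 - t) / d₂ ^ 2) * ‖v‖ ^ 2 := by
  have hs : 0 < 1 - t := by linarith
  have htri : ‖a * u + b * v‖ ≤ ‖a‖ * ‖u‖ + ‖b‖ * ‖v‖ := by
    simpa only [norm_mul] using norm_add_le (a * u) (b * v)
  have hcs : (‖a‖ * ‖u‖ + ‖b‖ * ‖v‖) ^ 2 ≤ (d₁ ^ 2 * ‖a‖ ^ 2 / t + d₂ ^ 2 * ‖b‖ ^ 2 / (1 - t)) *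
      (t / d₁ ^ 2 * ‖u‖ ^ 2 + (1 - t) / d₂ ^ 2 * ‖v‖ ^ 2) := by
    -- Lagrange's identity: the defect in the Cauchy–Schwarz inequality is a square.
    have e : (d₁ ^ 2 * ‖a‖ ^ 2 / t + d₂ ^ 2 * ‖b‖ ^ 2 / (1 - t)) *
        (t / d₁ ^ 2 * ‖u‖ ^ 2 + (1 - t) / d₂ ^ 2 * ‖v‖ ^ 2) - (‖a‖ * ‖u‖ + ‖b‖ * ‖v‖) ^ 2
        = (d₁ ^ 2 * (1 - t) * ‖a‖ * ‖v‖ - d₂ ^ 2 * t * ‖b‖ * ‖u‖) ^ 2 /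
          (d₁ ^ 2 * d₂ ^ 2 * t * (1 - t)) := by
      field_simp
      ring
    have : 0 ≤ (d₁ ^ 2 * (1 - t) * ‖a‖ * ‖v‖ - d₂ ^ 2 * t * ‖b‖ * ‖u‖) ^ 2 /
          (d₁ ^ 2 * d₂ ^ 2 * t * (1 - t)) := by positivity
    linarith
  calc _ ≤ (‖a‖ * ‖u‖ + ‖b‖ * ‖v‖) ^ 2 := pow_le_pow_left₀ (norm_nonneg _) htri 2
    _ ≤ _ := hcs
    _ ≤ E * (t / d₁ ^ 2 * ‖u‖ ^ 2 + (1 - t) / d₂ ^ 2 * ‖v‖ ^ 2) :=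
      mul_le_mul_of_nonneg_right h (by positivity)
    _ = _ := by ring

theorem methodError_method_le (hm : m ≤ N) (hθ : 0 < θ) (hα : ∀ j, 0 ≤ α j) (hδ : ∀ j, 0 < δ j)
    (h : IsSupportPair α δ a₀ η c j₁ j₂ t) (hne : j₁ ≠ j₂) {a : Fin N → RSpace d → ℂ}
    (ha : IsAdmissible θ α δ a₀ j₁ j₂ t a) :
    methodError (Lam (d := d) θ a₀) (fun j : Fin m => Lam θ (α (Fin.castLE hm j)))
      (functionClass m θ α δ) (fun j => δ (Fin.castLE hm j)) (method hm j₁ j₂ a)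
      ≤ ENNReal.ofReal (Real.exp (-broken α δ a₀)) := by
  refine iSup₂_le fun x hx => iSup₂_le fun y hy => ?_
  have hdom := h.inDomain hθ hα hx.1
  rw [← ofReal_norm]
  refine ENNReal.ofReal_le_ofReal ?_
  -- With zero as data for the indices beyond the first `m`, class constraints and measurement
  -- errors take the same form.
  have hδy : ∀ k, ‖Lam θ (α k) x - extendData y k‖ ≤ δ k := by
    intro k
    by_cases hk : (k : ℕ) < m
    · simpa [extendData, hk] using hy ⟨k, hk⟩
    · simpa [extendData, hk] using hx.2 k (not_lt.1 hk)
  have hsq := norm_sq_le_of_ae_le (z := Lam θ a₀ x - method hm j₁ j₂ a y)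
    (u := Lam θ (α j₁) x - extendData y j₁) (v := Lam θ (α j₂) x - extendData y j₂)
    (b₁ := Real.exp (-2 * broken α δ a₀) * (t / δ j₁ ^ 2))
    (b₂ := Real.exp (-2 * broken α δ a₀) * ((1 - t) / δ j₂ ^ 2)) (by
      filter_upwards [ha.eq, ha.le, fourierF_sub (Lam θ a₀ x) (method hm j₁ j₂ a y),
        fourierF_sub (Lam θ (α j₁) x) (extendData y j₁),
        fourierF_sub (Lam θ (α j₂) x) (extendData y j₂), fourierF_Lam hdom,
        fourierF_Lam (hx.1 j₁), fourierF_Lam (hx.1 j₂), methodSymbol_ae_eq hm hne a y,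
        fourierF_fourierFInv (ha.memLp_methodSymbol hm hδ h.pos h.lt_one hne y)]
        with ξ e1 e2 e3 e4 e5 e6 e7 e8 e9 e10
      -- The linear condition on `a` splits `ψ^{a₀} F x` into the two terms that the method
      -- approximates.
      have e : fourierF (Lam θ a₀ x - method hm j₁ j₂ a y) ξ
          = a j₁ ξ * fourierF (Lam θ (α j₁) x - extendData y j₁) ξ
            + a j₂ ξ * fourierF (Lam θ (α j₂) x - extendData y j₂) ξ := by
        rw [e3, e4, e5, e6, e7, e8, method, e10, e9, ← e1]
        ring
      rw [e]
      exact norm_add_mul_sq_le (hδ j₁) (hδ j₂) h.pos h.lt_one e2)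
  refine le_of_sq_le_sq ?_ (Real.exp_pos _).le
  have ht := h.pos
  have hs : 0 < 1 - t := by linarith [h.lt_one]
  have h₁ := hδ j₁
  have h₂ := hδ j₂
  have hE : Real.exp (-2 * broken α δ a₀) = Real.exp (-broken α δ a₀) ^ 2 := by
    rw [← Real.exp_nat_mul]; congr 1; push_cast; ring
  have q₁ := pow_le_pow_left₀ (norm_nonneg _) (hδy j₁) 2
  have q₂ := pow_le_pow_left₀ (norm_nonneg _) (hδy j₂) 2
  calc _ ≤ _ := hsq
    _ ≤ Real.exp (-2 * broken α δ a₀) * (t / δ j₁ ^ 2) * δ j₁ ^ 2 +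
        Real.exp (-2 * broken α δ a₀) * ((1 - t) / δ j₂ ^ 2) * δ j₂ ^ 2 := by gcongr
    _ = Real.exp (-2 * broken α δ a₀) := by field_simp; ring
    _ = _ := hE

theorem ofReal_exp_le_optimalError (hm : m ≤ N) (hd : 0 < d) (hθ : 0 < θ) (hα : ∀ j, 0 ≤ α j)
    (hδ : ∀ j, 0 < δ j) (h : IsSupportPair α δ a₀ η c j₁ j₂ t) :
    ENNReal.ofReal (Real.exp (-broken α δ a₀)) ≤
      optimalError (Lam (d := d) θ a₀) (fun j : Fin m => Lam θ (α (Fin.castLE hm j)))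
        (functionClass m θ α δ) (fun j => δ (Fin.castLE hm j)) := by
  refine le_iInf fun Φ => ?_
  have ha₀ : 0 ≤ a₀ := by
    rw [h.comb]
    exact add_nonneg (mul_nonneg h.pos.le (hα _)) (mul_nonneg (by linarith [h.lt_one]) (hα _))
  refine le_of_forall_lt fun b hb => ?_
  obtain ⟨b', hbb', hb'⟩ := exists_between hb
  have hbtop : b' ≠ ⊤ := hb'.ne_top
  refine hbb'.trans_le ?_
  have hB : b'.toReal < Real.exp (-c) * Real.exp (-η * a₀) := by
    rw [← ENNReal.ofReal_toReal hbtop, ENNReal.ofReal_lt_ofReal_iff_of_nonneg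
      ENNReal.toReal_nonneg, h.touch] at hb'
    rwa [← Real.exp_add, show -c + -η * a₀ = -(η * a₀ + c) by ring]
  -- With `A = e^{-c}` and `s = -η`, the bound `A e^{s α_k}` is `e^{-(η α_k + c)}`, which is at most
  -- `δ_k` by `le_line`.
  obtain ⟨x, hdom, hle, hge⟩ := exists_norm_Lam_le_and_le hd hθ ha₀ (Real.exp_pos (-c)) hB
  have hδx : ∀ k, ‖Lam θ (α k) x‖ ≤ δ k := by
    intro k
    refine (hle _ (hα k)).trans ?_
    rw [← Real.exp_add, ← Real.le_log_iff_exp_le (hδ k)]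
    have := h.le_line k
    rw [one_div, Real.log_inv] at this
    linarith
  have hmem : ∀ x' : L2 d, (∀ a, 0 ≤ a → InDomain θ a x') → (∀ k, ‖Lam θ (α k) x'‖ ≤ δ k) →
      ‖Lam θ a₀ x' - Φ 0‖ₑ ≤ methodError (Lam (d := d) θ a₀)
        (fun j : Fin m => Lam θ (α (Fin.castLE hm j)))
        (functionClass m θ α δ) (fun j => δ (Fin.castLE hm j)) Φ := by
    intro x' hx' hδx'
    exact le_iSup₂_of_le x' ⟨fun j => hx' _ (hα j), fun j _ => hδx' j⟩
      (le_iSup₂_of_le 0 (fun j => by simpa using hδx' _) le_rfl)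
  have hp := hmem x hdom hδx
  have hn := hmem (-x) (fun a ha => (hdom a ha).neg) fun k => by
    rw [Lam_neg (hdom _ (hα k)), norm_neg]; exact hδx k
  rw [Lam_neg (hdom _ ha₀)] at hn
  have hb'le : b' ≤ ENNReal.ofReal ‖Lam θ a₀ x‖ := by
    rw [← ENNReal.ofReal_toReal hbtop]
    exact ENNReal.ofReal_le_ofReal hge
  refine hb'le.trans ?_
  -- The method returns the same `Φ 0` for `x` and `-x`, and the two targets are `2‖Λ^{a₀} x‖`
  -- apart.
  have htri : ‖Lam θ a₀ x‖ ≤ max ‖Lam θ a₀ x - Φ 0‖ ‖-Lam θ a₀ x - Φ 0‖ := by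
    have h2 : (2 : ℝ) * ‖Lam θ a₀ x‖ ≤ ‖Lam θ a₀ x - Φ 0‖ + ‖-Lam θ a₀ x - Φ 0‖ := by
      have := norm_sub_le (Lam θ a₀ x - Φ 0) (-Lam θ a₀ x - Φ 0)
      rw [show Lam θ a₀ x - Φ 0 - (-Lam θ a₀ x - Φ 0) = (2 : ℝ) • Lam θ a₀ x by
        rw [two_smul]; abel, norm_smul] at this
      simpa using this
    rcases le_total ‖Lam θ a₀ x - Φ 0‖ ‖-Lam θ a₀ x - Φ 0‖ with h' | h'
    · exact le_max_of_le_right (by linarith)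
    · exact le_max_of_le_left (by linarith)
  rcases le_max_iff.1 htri with h' | h'
  · exact ((ENNReal.ofReal_le_ofReal h').trans_eq (ofReal_norm _)).trans hp
  · exact ((ENNReal.ofReal_le_ofReal h').trans_eq (ofReal_norm _)).trans hn

theorem method_eq_zero (hm : m ≤ N) (hM : indexM hm j₁ j₂ = ∅) (a : Fin N → RSpace d → ℂ) :
    method hm j₁ j₂ a = fun _ => 0 := by
  funext y
  have h0 : methodSymbol hm j₁ j₂ a y = 0 := by
    funext ξ
    simp [methodSymbol, hM]
  apply eq_of_fourierF_ae_eq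
  rw [method, h0]
  exact (fourierF_fourierFInv MemLp.zero).trans fourierF_zero.symm

end Recovery

end OptRec

theorem corollary2 (d N m : ℕ) (hd : 0 < d) (hm₁ : 1 ≤ m) (hm : m ≤ N)
    (θ : ℝ) (hθ : 0 < θ)
    (α δ : Fin N → ℝ) (hα : ∀ j, 0 ≤ α j) (hδ : ∀ j, 0 < δ j)
    (a₀ : ℝ) (ha₀ : a₀ ∈ convexHull ℝ (Set.range α)) (ha₀' : a₀ ∉ Set.range α) :
    -- the operator to be recovered is defined on the whole function space
    (∀ x ∈ OptRec.functionSpace (d := d) θ α, OptRec.InDomain θ a₀ x) ∧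
    -- the error of optimal recovery
    OptRec.optimalError (OptRec.Lam (d := d) θ a₀)
        (fun j : Fin m => OptRec.Lam θ (α (Fin.castLE hm j)))
        (OptRec.functionClass m θ α δ) (fun j => δ (Fin.castLE hm j))
      = ENNReal.ofReal (Real.exp (-OptRec.broken α δ a₀)) ∧
    -- a support line and two points on it exist
    (∃ (η c : ℝ) (j₁ j₂ : Fin N) (t : ℝ), OptRec.IsSupportPair α δ a₀ η c j₁ j₂ t) ∧
    -- for every choice of them:
    ∀ (η c : ℝ) (j₁ j₂ : Fin N) (t : ℝ), OptRec.IsSupportPair α δ a₀ η c j₁ j₂ t →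
      -- admissible functions exist, and if `M` is nonempty they all give optimal methods
      (∃ a : Fin N → OptRec.RSpace d → ℂ, OptRec.IsAdmissible θ α δ a₀ j₁ j₂ t a) ∧
      ((OptRec.indexM hm j₁ j₂).Nonempty →
        ∀ a : Fin N → OptRec.RSpace d → ℂ, OptRec.IsAdmissible θ α δ a₀ j₁ j₂ t a →
          (∀ y : Fin m → OptRec.L2 d,
            MeasureTheory.MemLp (OptRec.methodSymbol hm j₁ j₂ a y) 2 MeasureTheory.volume) ∧
          OptRec.IsOptimalMethod (OptRec.Lam (d := d) θ a₀)
            (fun j : Fin m => OptRec.Lam θ (α (Fin.castLE hm j)))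
            (OptRec.functionClass m θ α δ) (fun j => δ (Fin.castLE hm j))
            (OptRec.method hm j₁ j₂ a)) ∧
      -- if `M` is empty, the zero method is optimal
      (OptRec.indexM hm j₁ j₂ = ∅ →
        OptRec.IsOptimalMethod (OptRec.Lam (d := d) θ a₀)
          (fun j : Fin m => OptRec.Lam θ (α (Fin.castLE hm j)))
          (OptRec.functionClass m θ α δ) (fun j => δ (Fin.castLE hm j))
          (fun _ => 0)) ∧
      -- the exact inequality for the operators `Λ_θ`
      OptRec.IsExactInequality (OptRec.functionSpace (d := d) θ α) (OptRec.Lam θ a₀)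
        ![OptRec.Lam θ (α j₁), OptRec.Lam θ (α j₂)]
        (fun r => r 0 ^ t * r 1 ^ (1 - t)) ∧
      -- the exact inequality for the powers of `-Δ`
      OptRec.IsExactInequality (OptRec.functionSpace (d := d) 2 α) (OptRec.fracLaplacian a₀)
        ![OptRec.fracLaplacian (α j₁), OptRec.fracLaplacian (α j₂)]
        (fun r => r 0 ^ t * r 1 ^ (1 - t)) := by
  have lower := fun η c j₁ j₂ t (h : OptRec.IsSupportPair α δ a₀ η c j₁ j₂ t) =>
    OptRec.ofReal_exp_le_optimalError (d := d) hm hd hθ hα hδ h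
  have upper := fun η c j₁ j₂ t (h : OptRec.IsSupportPair α δ a₀ η c j₁ j₂ t) a
      (ha : OptRec.IsAdmissible θ α δ a₀ j₁ j₂ t a) =>
    OptRec.methodError_method_le (d := d) hm hθ hα hδ h (ne_of_apply_ne α (h.ne ha₀')) ha
  have adm := fun η c j₁ j₂ t (h : OptRec.IsSupportPair α δ a₀ η c j₁ j₂ t) =>
    h.exists_isAdmissible (d := d) hθ hα hδ (ne_of_apply_ne α (h.ne ha₀'))
  obtain ⟨η, c, j₁, j₂, t, h⟩ := OptRec.exists_isSupportPair (δ := δ) ha₀ ha₀'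
  obtain ⟨a, ha⟩ := adm η c j₁ j₂ t h
  have hE := le_antisymm ((iInf_le _ _).trans (upper η c j₁ j₂ t h a ha)) (lower η c j₁ j₂ t h)
  refine ⟨fun x hx => h.inDomain hθ hα hx, hE, ⟨η, c, j₁, j₂, t, h⟩, ?_⟩
  clear! η c j₁ j₂ t a
  intro η c j₁ j₂ t h
  have hne := ne_of_apply_ne α (h.ne ha₀')
  have opt : ∀ a, OptRec.IsAdmissible θ α δ a₀ j₁ j₂ t a →
      OptRec.IsOptimalMethod (OptRec.Lam (d := d) θ a₀)
        (fun j : Fin m => OptRec.Lam θ (α (Fin.castLE hm j)))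
        (OptRec.functionClass m θ α δ) (fun j => δ (Fin.castLE hm j))
        (OptRec.method hm j₁ j₂ a) := fun a ha =>
    le_antisymm ((upper η c j₁ j₂ t h a ha).trans (lower η c j₁ j₂ t h)) (iInf_le _ _)
  refine ⟨adm η c j₁ j₂ t h, fun _ a ha =>
    ⟨ha.memLp_methodSymbol hm hδ h.pos h.lt_one hne, opt a ha⟩, fun hM => ?_, ?_, ?_⟩
  -- For empty `M` the optimal method built from any admissible functions is itself the zero method.
  · obtain ⟨a, ha⟩ := adm η c j₁ j₂ t h
    have := opt a ha
    rwa [OptRec.method_eq_zero hm hM] at this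
  · rw [h.comb]
    exact OptRec.isExactInequality_Lam hd hθ hα (h.ne ha₀') h.pos h.lt_one
  -- A support pair does not involve `θ`, so the same pair serves for `θ = 2`, where `ψ_2(ξ) =
  -- |ξ|²`.
  · simp only [OptRec.fracLaplacian_eq_Lam]
    rw [h.comb]
    exact OptRec.isExactInequality_Lam hd two_pos hα (h.ne ha₀') h.pos h.lt_one
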